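/- Let $d\ge 1$ and $N\ge 2$ be integers, and let $B$ be a real invertible $d\times d$ matrix. Write $B^\sharp=(B^T)^{-1}$ and assume that $$B^\sharp\mathbf n\notin(-N,N)^d\qquad\text{for all }\mathbf n\in\mathbb Z^d\setminus\{\mathbf 0\}.$$ Define $k:\mathbb R^d\to\mathbb R$ by $$k(\mathbf x)=\sqrt{|\det B|}\left(\frac{4^{N-1}}{N\binom{2N-2}{N-1}}\right)^{d/2}\left(\prod_{j=1}^d\sin^{N-1}(\pi x_j/N)\right)\chi_{[0,N]^d}(\mathbf x),$$ where $\chi_{[0,N]^d}$ is the indicator function of the cube $[0,N]^d$. For $\mathbf y\in\mathbb R^d$ let $(T_{\mathbf y}f)(\mathbf x)=f(\mathbf x-\mathbf y)$ and $(E_{\mathbf y}f)(\mathbf x)=e^{2\pi i\,\mathbf y\cdot\mathbf x}f(\mathbf x)$. Then $k\in C^{N-2}(\mathbb R^d)$, $k\in L^2(\mathbb R^d)$, and the Gabor system $\{E_{B\mathbf m}T_{\mathbf n}k\}_{\mathbf m,\mathbf n\in\mathbb Z^d}$ is a tight frame for the complex Hilbert space $L^2(\mathbb R^d)$ with frame bound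 $1$; that is, $$\sum_{\mathbf m,\mathbf n\in\mathbb Z^d}|\langle f,E_{B\mathbf m}T_{\mathbf n}k\rangle|^2=\|f\|^2\qquad\text{for all }f\in L^2(\mathbb R^d).$$ -/

import Mathlib

open MeasureTheory

namespace GaborL2

noncomputable section

/-- The integer vector `n ∈ ℤ^d`, viewed in the Euclidean space `ℝ^d`. -/
def intVec {d : ℕ} (n : Fin d → ℤ) : EuclideanSpace ℝ (Fin d) :=
  WithLp.toLp 2 (fun j => (n j : ℝ))

/-- The action `x ↦ A x` of a real `d × d` matrix on `ℝ^d`. -/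
def act {d : ℕ} (A : Matrix (Fin d) (Fin d) ℝ) (x : EuclideanSpace ℝ (Fin d)) :
    EuclideanSpace ℝ (Fin d) :=
  WithLp.toLp 2 (A.mulVec (fun j => x j))

/-- `B^♯ = (Bᵀ)⁻¹`. -/
def sharp {d : ℕ} (B : Matrix (Fin d) (Fin d) ℝ) : Matrix (Fin d) (Fin d) ℝ :=
  (B.transpose)⁻¹

/-- The closed cube `[0, N]^d`. -/
def closedCube (d N : ℕ) : Set (EuclideanSpace ℝ (Fin d)) :=
  {x | ∀ j, x j ∈ Set.Icc (0 : ℝ) N}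

/-- The open cube `(-N, N)^d`. -/
def openCube (d N : ℕ) : Set (EuclideanSpace ℝ (Fin d)) :=
  {x | ∀ j, x j ∈ Set.Ioo (-(N : ℝ)) N}

/-- Translation: `(T_y f)(x) = f (x - y)`. -/
def translation {d : ℕ} (y : EuclideanSpace ℝ (Fin d)) (f : EuclideanSpace ℝ (Fin d) → ℂ) :
    EuclideanSpace ℝ (Fin d) → ℂ :=
  fun x => f (x - y)

/-- Modulation: `(E_y f)(x) = e^{2 π i y · x} f x`. -/
def modulation {d : ℕ} (y : EuclideanSpace ℝ (Fin d)) (f : EuclideanSpace ℝ (Fin d) → ℂ) :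
    EuclideanSpace ℝ (Fin d) → ℂ :=
  fun x => Complex.exp (2 * Real.pi * Complex.I * ((inner ℝ y x : ℝ) : ℂ)) * f x

theorem memLp_translation {d : ℕ} (y : EuclideanSpace ℝ (Fin d))
    {f : EuclideanSpace ℝ (Fin d) → ℂ} (hf : MemLp f 2 volume) :
    MemLp (translation y f) 2 volume :=
  hf.comp_measurePreserving (measurePreserving_sub_right volume y)

theorem memLp_modulation {d : ℕ} (y : EuclideanSpace ℝ (Fin d))
    {f : EuclideanSpace ℝ (Fin d) → ℂ} (hf : MemLp f 2 volume) :
    MemLp (modulation y f) 2 volume := by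
  have hc : Continuous fun x : EuclideanSpace ℝ (Fin d) =>
      Complex.exp (2 * Real.pi * Complex.I * ((inner ℝ y x : ℝ) : ℂ)) := by fun_prop
  refine hf.of_le (hc.aestronglyMeasurable.mul hf.1) (Filter.Eventually.of_forall fun x => ?_)
  have h : 2 * (Real.pi : ℂ) * Complex.I * ((inner ℝ y x : ℝ) : ℂ)
      = ((2 * Real.pi * inner ℝ y x : ℝ) : ℂ) * Complex.I := by push_cast; ring
  simp only [modulation]
  rw [norm_mul, h, Complex.norm_exp_ofReal_mul_I, one_mul]

/-- The Gabor system `{E_{Bm} T_n g}`, indexed by `(m, n) ∈ ℤ^d × ℤ^d`, as a family in the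
complex Hilbert space `L²(ℝ^d)`. -/
def gaborSystem {d : ℕ} (B : Matrix (Fin d) (Fin d) ℝ) (g : EuclideanSpace ℝ (Fin d) → ℂ)
    (hg : MemLp g 2 volume) (p : (Fin d → ℤ) × (Fin d → ℤ)) :
    Lp ℂ 2 (volume : Measure (EuclideanSpace ℝ (Fin d))) :=
  (memLp_modulation (act B (intVec p.1)) (memLp_translation (intVec p.2) hg)).toLp
    (modulation (act B (intVec p.1)) (translation (intVec p.2) g))

/-- A family `v` in a Hilbert space is a tight frame with frame bound `A > 0`: for all `f`,
`∑ i, |⟨f, v i⟩|² = A ‖f‖²`, the series being (unconditionally) convergent. -/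
def IsTightFrame {ι H : Type*} [NormedAddCommGroup H] [InnerProductSpace ℂ H]
    (v : ι → H) (A : ℝ) : Prop :=
  0 < A ∧ ∀ f : H, HasSum (fun i => ‖(inner ℂ f (v i) : ℂ)‖ ^ 2) (A * ‖f‖ ^ 2)

/-- The window
`k(x) = √|det B| (4^(N-1) / (N * C(2N-2, N-1)))^(d/2) ∏_j sin^(N-1)(π x_j / N) χ_{[0,N]^d}(x)`. -/
def window {d : ℕ} (N : ℕ) (B : Matrix (Fin d) (Fin d) ℝ) : EuclideanSpace ℝ (Fin d) → ℝ :=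
  (closedCube d N).indicator fun x =>
    √|B.det| * ((4 : ℝ) ^ (N - 1) / ((N : ℝ) * ((2 * N - 2).choose (N - 1) : ℝ))) ^ ((d : ℝ) / 2)
      * ∏ j, Real.sin (Real.pi * x j / N) ^ (N - 1)

end

end GaborL2

/-! Fix `n` and put `g(x) = k(x - n) * conj (f x)`, so that `⟨f, E_{Bm} T_n k⟩` is the integral of
`g` against `e^{2πi Bm·x}`. Substituting `x = B^♯ y` turns this exponential into the character
`e^{2πi m·y}`, because `Bᵀ B^♯ = 1`. Since `k` vanishes off `(0, N)^d`, the cube hypothesis makes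
the `B^♯ ℤ^d`-translates of the support of `g` disjoint. The periodization of `g ∘ B^♯` thus never
has two nonzero terms at a point, and Parseval on the torus (`hasSum_sq_integral_character`) gives
`∑_m |⟨f, E_{Bm} T_n k⟩|² = |det B|⁻¹ ∫ k(x - n)² |f x|²`. Summing over `n` leaves `∑_n k(x - n)² =
|det B|` (`hasSum_window_sq`). By the product form this is one-dimensional: `sin^(2(N-1))` has only
the frequencies `2j` with `|j| ≤ N - 1`, and summing over `N` points spaced by `π / N` kills all but
`j = 0`. Smoothness holds because `sin^(N-1)` vanishes to order `N - 1` at both ends of `[0, N]`. -/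

open MeasureTheory

namespace GaborL2

-- Periodization and Parseval's identity

attribute [local instance] instMeasureSpaceUnitAddCircle

/-- The half-open unit cube `(0, 1]^d`. -/
def unitCube (d : ℕ) : Set (Fin d → ℝ) :=
  {x | ∀ i, x i ∈ Set.Ioc ((0 : Fin d → ℝ) i) ((0 : Fin d → ℝ) i + 1)}

/-- The integer vector `n ∈ ℤ^d`, viewed as a real vector. -/
def intCoe {d : ℕ} (n : Fin d → ℤ) : Fin d → ℝ := fun j => (n j : ℝ)

/-- The character `y ↦ e^{2 π i m · y}`. -/
noncomputable def character {d : ℕ} (m : Fin d → ℤ) (y : Fin d → ℝ) : ℂ :=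
  Complex.exp (2 * Real.pi * Complex.I * ((∑ j, (m j : ℝ) * y j : ℝ) : ℂ))

theorem measurableSet_unitCube (d : ℕ) : MeasurableSet (unitCube d) := by
  have : unitCube d = Set.univ.pi fun i =>
      Set.Ioc ((0 : Fin d → ℝ) i) ((0 : Fin d → ℝ) i + 1) := by
    ext; simp [unitCube]
  rw [this]
  exact MeasurableSet.univ_pi fun i => measurableSet_Ioc

/-- The cube is open on the left, hence `⌈x j⌉ - 1` and not the floor. Existence and uniqueness of
`n` give the tiling of space. -/
theorem sub_intCoe_mem_unitCube {d : ℕ} (x : Fin d → ℝ) (n : Fin d → ℤ) :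
    x - intCoe n ∈ unitCube d ↔ n = fun j => ⌈x j⌉ - 1 := by
  simp only [unitCube, intCoe, Set.mem_ofPred_eq, Pi.sub_apply, Pi.zero_apply, zero_add,
    Set.mem_Ioc, sub_pos, funext_iff]
  refine forall_congr' fun j => ?_
  rw [eq_sub_iff_add_eq, eq_comm, Int.ceil_eq_iff]
  push_cast
  constructor <;> rintro ⟨h1, h2⟩ <;> constructor <;> linarith

theorem volume_eq_sum_map_unitCube (d : ℕ) :
    (volume : Measure (Fin d → ℝ)) =
      Measure.sum fun n : Fin d → ℤ => (volume.restrict (unitCube d)).map (· + intCoe n) := by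
  set D : (Fin d → ℤ) → Set (Fin d → ℝ) := fun n => (· - intCoe n) ⁻¹' unitCube d with hD
  have hm : ∀ n, MeasurableSet (D n) := fun n =>
    (measurable_sub_const (intCoe n)) (measurableSet_unitCube d)
  have hmap : ∀ n : Fin d → ℤ,
      (volume.restrict (unitCube d)).map (· + intCoe n) = volume.restrict (D n) := by
    intro n
    have h := ((measurePreserving_add_right (volume : Measure (Fin d → ℝ))
      (intCoe n)).restrict_preimage_emb (measurableEmbedding_addRight _) (D n)).map_eq
    have h2 : (· + intCoe n) ⁻¹' D n = unitCube d := by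
      ext x; simp [hD]
    rwa [h2] at h
  simp only [hmap]
  rw [← Measure.restrict_iUnion _ hm]
  · have : (⋃ n, D n) = Set.univ := by
      refine Set.eq_univ_of_forall fun x => Set.mem_iUnion.2 ⟨fun j => ⌈x j⌉ - 1, ?_⟩
      exact (sub_intCoe_mem_unitCube x _).2 rfl
    rw [this, Measure.restrict_univ]
  · intro n m hnm
    refine Set.disjoint_left.2 fun x hx hx' => hnm ?_
    rw [(sub_intCoe_mem_unitCube x n).1 hx, (sub_intCoe_mem_unitCube x m).1 hx']

theorem lintegral_eq_tsum_unitCube {d : ℕ} (φ : (Fin d → ℝ) → ENNReal) :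
    ∫⁻ x, φ x = ∑' n : Fin d → ℤ, ∫⁻ x in unitCube d, φ (x + intCoe n) := by
  conv_lhs => rw [volume_eq_sum_map_unitCube d]
  rw [lintegral_sum_measure]
  refine tsum_congr fun n => ?_
  exact (measurableEmbedding_addRight (intCoe n)).lintegral_map φ

variable {d : ℕ} {E : Type*} [NormedAddCommGroup E]

theorem tsum_lintegral_enorm_unitCube_ne_top {φ : (Fin d → ℝ) → E} (hφ : Integrable φ) :
    ∑' n : Fin d → ℤ, ∫⁻ x in unitCube d, ‖φ (x + intCoe n)‖ₑ ≠ ⊤ := by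
  rw [← lintegral_eq_tsum_unitCube (fun x => ‖φ x‖ₑ)]
  exact hφ.2.ne

theorem integral_eq_integral_tsum_unitCube [NormedSpace ℝ E] {φ : (Fin d → ℝ) → E} (hφ : Integrable φ) :
    ∫ x, φ x = ∫ x in unitCube d, ∑' n : Fin d → ℤ, φ (x + intCoe n) := by
  rw [integral_tsum (fun n => (hφ.comp_add_right _).1.restrict)
    (tsum_lintegral_enorm_unitCube_ne_top hφ)]
  conv_lhs => rw [volume_eq_sum_map_unitCube d]
  rw [integral_sum_measure (by rwa [← volume_eq_sum_map_unitCube d])]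
  refine tsum_congr fun n => ?_
  exact (measurableEmbedding_addRight (intCoe n)).integral_map φ

/-- Each orbit has at most one nonzero term, so any map fixing `0` passes through the sum without a
summability hypothesis. This is applied to squared norms, real and extended. -/
theorem comp_tsum_of_disjoint {h : (Fin d → ℝ) → ℂ}
    (hdisj : ∀ y (n : Fin d → ℤ), n ≠ 0 → h y ≠ 0 → h (y + intCoe n) = 0)
    {F : Type*} [AddCommMonoid F] [TopologicalSpace F]
    (G : (Fin d → ℤ) → ℂ → F) (hG : ∀ n, G n 0 = 0) (y : Fin d → ℝ) :
    ∃ n₀ : Fin d → ℤ, ∑' n : Fin d → ℤ, h (y + intCoe n) = h (y + intCoe n₀) ∧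
      ∑' n : Fin d → ℤ, G n (h (y + intCoe n)) = G n₀ (h (y + intCoe n₀)) := by
  obtain ⟨n₀, hn₀⟩ : ∃ n₀ : Fin d → ℤ, ∀ n, n ≠ n₀ → h (y + intCoe n) = 0 := by
    by_cases hex : ∃ n₀ : Fin d → ℤ, h (y + intCoe n₀) ≠ 0
    · obtain ⟨n₀, h0⟩ := hex
      refine ⟨n₀, fun n hn => ?_⟩
      have := hdisj _ (n - n₀) (sub_ne_zero.2 hn) h0
      rwa [show y + intCoe n₀ + intCoe (n - n₀) = y + intCoe n by
        ext j; simp [intCoe]] at this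
    · push Not at hex
      exact ⟨0, fun n _ => hex n⟩
  exact ⟨n₀, tsum_eq_single n₀ hn₀, tsum_eq_single n₀ fun n hn => by rw [hn₀ n hn, hG]⟩

theorem character_add_intCoe (m n : Fin d → ℤ) (y : Fin d → ℝ) :
    character m (y + intCoe n) = character m y := by
  unfold character
  rw [Complex.exp_eq_exp_iff_exists_int]
  refine ⟨∑ j, m j * n j, ?_⟩
  simp only [intCoe, Pi.add_apply, mul_add, Finset.sum_add_distrib]
  push_cast
  ring

theorem mFourier_coe_eq_character (m : Fin d → ℤ) (y : Fin d → ℝ) :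
    UnitAddTorus.mFourier m (fun i => (y i : UnitAddCircle)) = character m y := by
  simp only [UnitAddTorus.mFourier, ContinuousMap.coe_mk, fourier_coe_apply, character]
  rw [← Complex.exp_sum]
  push_cast
  rw [Finset.mul_sum]
  congr 1
  refine Finset.sum_congr rfl fun j _ => ?_
  simp only [div_one]
  ring

theorem norm_character (m : Fin d → ℤ) (y : Fin d → ℝ) : ‖character m y‖ = 1 := by
  have h : character m y
      = Complex.exp (((2 * Real.pi * ∑ j, (m j : ℝ) * y j : ℝ) : ℂ) * Complex.I) := by
    unfold character; congr 1; push_cast; ring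
  rw [h, Complex.norm_exp_ofReal_mul_I]

theorem continuous_character (m : Fin d → ℤ) : Continuous (character m) := by
  unfold character
  fun_prop

/-- **Parseval's identity** for a function on `ℝ^d` whose support has pairwise disjoint integer
translates. -/
theorem hasSum_sq_integral_character {h : (Fin d → ℝ) → ℂ} (h1 : Integrable h)
    (h2 : MemLp h 2 volume)
    (hdisj : ∀ y (n : Fin d → ℤ), n ≠ 0 → h y ≠ 0 → h (y + intCoe n) = 0) :
    HasSum (fun m : Fin d → ℤ => ‖∫ y, character m y * h y‖ ^ 2) (∫ y, ‖h y‖ ^ 2) := by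
  set P : (Fin d → ℝ) → ℂ := fun y => ∑' n : Fin d → ℤ, h (y + intCoe n) with hP
  have hPm : AEStronglyMeasurable P (volume.restrict (unitCube d)) :=
    (AEMeasurable.tsum fun n =>
      (h1.comp_add_right (intCoe n)).1.aemeasurable.restrict).aestronglyMeasurable
  have hsq : Integrable fun y => ‖h y‖ ^ 2 := (memLp_two_iff_integrable_sq_norm h1.1).1 h2
  have hPsq : ∀ y, ‖P y‖ ^ 2 = ∑' n : Fin d → ℤ, ‖h (y + intCoe n)‖ ^ 2 := by
    intro y
    obtain ⟨n₀, e1, e2⟩ := comp_tsum_of_disjoint hdisj (fun _ z => ‖z‖ ^ 2) (by simp) y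
    rw [hP, e2]; simp only [e1]
  have hPint : ∫ y in unitCube d, ‖P y‖ ^ 2 = ∫ y, ‖h y‖ ^ 2 := by
    simp only [hPsq]
    exact (integral_eq_integral_tsum_unitCube hsq).symm
  have hP2 : MemLp P 2 (volume.restrict (unitCube d)) := by
    refine (memLp_two_iff_integrable_sq_norm hPm).2 ⟨hPm.norm.pow 2, ?_⟩
    have hle : ∀ y, ‖‖P y‖ ^ 2‖ₑ = ∑' n : Fin d → ℤ, ‖‖h (y + intCoe n)‖ ^ 2‖ₑ := by
      intro y
      obtain ⟨n₀, e1, e2⟩ := comp_tsum_of_disjoint hdisj (fun _ z => ‖‖z‖ ^ 2‖ₑ) (by simp) y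
      rw [hP, e2]; simp only [e1]
    unfold HasFiniteIntegral
    simp only [hle]
    rw [lintegral_tsum fun n => (hsq.comp_add_right (intCoe n)).1.enorm.restrict]
    exact (tsum_lintegral_enorm_unitCube_ne_top hsq).lt_top
  set e := UnitAddTorus.measurableEquivPiIoc (0 : Fin d → ℝ) with he
  set H : UnitAddTorus (Fin d) → ℂ := fun t => P (e t).1 with hH
  have hHP : ∀ y ∈ unitCube d, H (fun i => (y i : UnitAddCircle)) = P y := by
    intro y hy
    have := e.apply_symm_apply ⟨y, hy⟩
    rw [he, UnitAddTorus.coe_symm_measurableEquivPiIoc_apply] at this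
    simp only [hH, he, this]
  have hH2 : MemLp H 2 volume := by
    have hmp : MeasurePreserving (fun t => (e t).1) volume (volume.restrict (unitCube d)) :=
      (measurePreserving_subtype_coe (measurableSet_unitCube d)).comp
        (UnitAddTorus.measurePreserving_equivPiIoc (0 : Fin d → ℝ))
    exact hP2.comp_measurePreserving hmp
  have key := UnitAddTorus.hasSum_sq_mFourierCoeff (hH2.toLp H)
  have hcoe := hH2.coeFn_toLp
  have e1 : ∫ t, ‖(hH2.toLp H) t‖ ^ 2 = ∫ y, ‖h y‖ ^ 2 := by
    rw [← hPint, integral_congr_ae (g := fun t => ‖H t‖ ^ 2)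
      (hcoe.mono fun t ht => by simp only [ht]),
      UnitAddTorus.integral_preimage _ (0 : Fin d → ℝ)]
    exact setIntegral_congr_fun (measurableSet_unitCube d) fun y hy => by
      simp only [hHP y hy]
  -- The coefficient at `-m` integrates against the character of index `m`; the sign is undone by
  -- reindexing along negation.
  have e2 : ∀ m, UnitAddTorus.mFourierCoeff (hH2.toLp H) (-m) = ∫ y, character m y * h y := by
    intro m
    have : UnitAddTorus.mFourierCoeff (hH2.toLp H) (-m) = UnitAddTorus.mFourierCoeff H (-m) :=
      integral_congr_ae (hcoe.mono fun t ht => by simp only [ht])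
    rw [this, UnitAddTorus.mFourierCoeff_eq_integral _ _ (0 : Fin d → ℝ), neg_neg,
      integral_eq_integral_tsum_unitCube
        (h1.bdd_mul (continuous_character m).aestronglyMeasurable
          (Filter.Eventually.of_forall fun y => (norm_character m y).le))]
    refine setIntegral_congr_fun (measurableSet_unitCube d) fun y hy => ?_
    simp only [hHP y hy, mFourier_coe_eq_character, smul_eq_mul, character_add_intCoe]
    rw [tsum_mul_left]
  rw [e1] at key
  have := (Equiv.neg (Fin d → ℤ)).hasSum_iff.2 key
  refine this.congr_fun fun m => ?_
  simp [e2]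

end GaborL2

/-! ### Smoothness of the window and the trigonometric sum -/

namespace GaborL2

/-- Cutting off a differentiable function at points where it vanishes to second order. -/
theorem hasDerivAt_indicator_of_frontier {S : Set ℝ} {G G' : ℝ → ℝ}
    (hG : ∀ x, HasDerivAt G (G' x) x) (h0 : ∀ x ∈ frontier S, G x = 0)
    (h1 : ∀ x ∈ frontier S, G' x = 0) (x : ℝ) :
    HasDerivAt (S.indicator G) (S.indicator G' x) x := by
  by_cases hx : x ∈ frontier S
  · have e1 : S.indicator G x = 0 := Set.indicator_apply_eq_zero.2 fun _ => h0 x hx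
    have e2 : S.indicator G' x = 0 := Set.indicator_apply_eq_zero.2 fun _ => h1 x hx
    have h := hG x
    rw [h1 x hx, hasDerivAt_iff_isLittleO] at h
    rw [e2, hasDerivAt_iff_isLittleO]
    simp only [smul_zero, sub_zero, h0 x hx, e1] at h ⊢
    -- At a frontier point `G` is itself `o(y - x)`, and cutting off only decreases its absolute
    -- value.
    refine Asymptotics.IsBigO.trans_isLittleO (Asymptotics.IsBigO.of_bound 1 ?_) h
    refine Filter.Eventually.of_forall fun y => ?_
    rw [one_mul]
    exact norm_indicator_le_norm_self _ _
  · by_cases hxS : x ∈ S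
    · have hint : S ∈ nhds x := by
        by_contra hcon
        exact hx ⟨subset_closure hxS, fun hi => hcon (mem_interior_iff_mem_nhds.1 hi)⟩
      rw [Set.indicator_of_mem hxS]
      refine (hG x).congr_of_eventuallyEq ?_
      filter_upwards [hint] with y hy using Set.indicator_of_mem hy _
    · have hint : Sᶜ ∈ nhds x := by
        by_contra hcon
        refine hx ?_
        rw [← frontier_compl]
        exact ⟨subset_closure hxS, fun hi => hcon (mem_interior_iff_mem_nhds.1 hi)⟩
      rw [Set.indicator_of_notMem hxS]
      refine (hasDerivAt_const x (0 : ℝ)).congr_of_eventuallyEq ?_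
      filter_upwards [hint] with y hy using Set.indicator_of_notMem hy _

/-- If `g` vanishes on the frontier of `S`, then `g ^ (n + 1)` cut off outside `S` is `C^n`. -/
theorem contDiff_indicator_pow_mul {S : Set ℝ} {g : ℝ → ℝ}
    (hg : ContDiff ℝ (⊤ : ℕ∞) g) (h0 : ∀ x ∈ frontier S, g x = 0) (n : ℕ) :
    ∀ {q : ℝ → ℝ}, ContDiff ℝ (⊤ : ℕ∞) q →
      ContDiff ℝ (n : WithTop ℕ∞) (S.indicator fun x => g x ^ (n + 1) * q x) := by
  -- The free smooth factor `q` closes the class under differentiation: the derivative of `g ^ (n +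
  -- 2) * q` is `g ^ (n + 1)` times a smooth function.
  induction n with
  | zero =>
    intro q hq
    rw [Nat.cast_zero, contDiff_zero]
    refine Continuous.indicator (fun x hx => ?_) ((hg.continuous.pow _).mul hq.continuous)
    simp [h0 x hx]
  | succ n ih =>
    intro q hq
    have hg' : ContDiff ℝ (⊤ : ℕ∞) (deriv g) := (contDiff_infty_iff_deriv.1 hg).2
    have hq' : ContDiff ℝ (⊤ : ℕ∞) (deriv q) := (contDiff_infty_iff_deriv.1 hq).2
    have hd : ∀ x, HasDerivAt (fun x => g x ^ (n + 1 + 1) * q x)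
        (g x ^ (n + 1) * (((n : ℝ) + 2) * deriv g x * q x + g x * deriv q x)) x := by
      intro x
      have hgx := ((contDiff_infty_iff_deriv.1 hg).1 x).hasDerivAt
      have hqx := ((contDiff_infty_iff_deriv.1 hq).1 x).hasDerivAt
      refine ((hgx.pow (n + 1 + 1)).mul hqx).congr_deriv ?_
      simp only [Pi.pow_apply, Nat.add_sub_cancel]
      push_cast
      ring
    have hD := hasDerivAt_indicator_of_frontier (S := S) hd
      (fun x hx => by simp [h0 x hx]) (fun x hx => by simp [h0 x hx])
    rw [Nat.cast_succ, contDiff_succ_iff_deriv]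
    refine ⟨fun x => (hD x).differentiableAt, fun h => absurd h (by simp), ?_⟩
    rw [show deriv (S.indicator fun x => g x ^ (n + 1 + 1) * q x) = _ from
      funext fun x => (hD x).deriv]
    exact ih (((contDiff_const.mul hg').mul hq).add (hg.mul hq'))

/-- The one-dimensional profile of the window. -/
noncomputable def profile (N : ℕ) : ℝ → ℝ :=
  (Set.Icc (0 : ℝ) N).indicator fun t => Real.sin (Real.pi * t / N) ^ (N - 1)

theorem contDiff_profile {N : ℕ} (hN : 2 ≤ N) :
    ContDiff ℝ ((N - 2 : ℕ) : WithTop ℕ∞) (profile N) := by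
  have hN0 : (0 : ℝ) < N := by positivity
  have h := contDiff_indicator_pow_mul (S := Set.Icc (0 : ℝ) N)
    (g := fun t => Real.sin (Real.pi * t / N)) (q := fun _ => 1)
    (Real.contDiff_sin.comp (by fun_prop)) ?_ (N - 2) contDiff_const
  · unfold profile
    simpa only [mul_one, show N - 2 + 1 = N - 1 by omega] using h
  · intro x hx
    rw [frontier_Icc hN0.le] at hx
    rcases hx with rfl | rfl
    · simp
    · simp [hN0.ne']

/-- The endpoints are included because `N - 1 ≠ 0`; this is why separation by the open cube
suffices. -/
theorem profile_eq_zero {N : ℕ} (hN : 2 ≤ N) {t : ℝ} (ht : t ∉ Set.Ioo (0 : ℝ) N) :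
    profile N t = 0 := by
  have hN0 : (0 : ℝ) < N := by positivity
  have hN1 : N - 1 ≠ 0 := by omega
  by_cases h : t ∈ Set.Icc (0 : ℝ) N
  · rw [profile, Set.indicator_of_mem h]
    have : t = 0 ∨ t = N := by
      by_contra hcon
      push Not at hcon
      exact ht ⟨lt_of_le_of_ne h.1 hcon.1.symm, lt_of_le_of_ne h.2 hcon.2⟩
    rcases this with rfl | rfl
    · simp [hN1]
    · simp [hN0.ne', hN1]
  · rw [profile, Set.indicator_of_notMem h]

theorem window_eq_prod {d : ℕ} (N : ℕ) (B : Matrix (Fin d) (Fin d) ℝ)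
    (x : EuclideanSpace ℝ (Fin d)) :
    window N B x = √|B.det| *
      ((4 : ℝ) ^ (N - 1) / ((N : ℝ) * ((2 * N - 2).choose (N - 1) : ℝ))) ^ ((d : ℝ) / 2) *
        ∏ j, profile N (x j) := by
  by_cases hx : x ∈ closedCube d N
  · rw [window, Set.indicator_of_mem hx]
    congr 1
    refine Finset.prod_congr rfl fun j _ => ?_
    rw [profile, Set.indicator_of_mem (hx j)]
  · rw [window, Set.indicator_of_notMem hx]
    obtain ⟨j, hj⟩ : ∃ j, x j ∉ Set.Icc (0 : ℝ) N := by
      by_contra hcon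
      push Not at hcon
      exact hx hcon
    rw [Finset.prod_eq_zero (Finset.mem_univ j), mul_zero]
    rw [profile, Set.indicator_of_notMem hj]

theorem contDiff_window {d N : ℕ} (hN : 2 ≤ N) (B : Matrix (Fin d) (Fin d) ℝ) :
    ContDiff ℝ ((N - 2 : ℕ) : WithTop ℕ∞) (window N B) := by
  rw [show window N B = _ from funext (window_eq_prod N B)]
  refine contDiff_const.mul (contDiff_prod fun j _ => ?_)
  exact (contDiff_profile hN).comp (contDiff_piLp_apply 2)

theorem memLp_window {d N : ℕ} (hN : 2 ≤ N) (B : Matrix (Fin d) (Fin d) ℝ) :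
    MemLp (fun x => (window N B x : ℂ)) 2 volume := by
  have hc : Continuous (fun x => (window N B x : ℂ)) :=
    Complex.continuous_ofReal.comp (contDiff_window hN B).continuous
  have hK : IsCompact (closedCube d N) := by
    have : closedCube d N = (EuclideanSpace.equiv (Fin d) ℝ).toHomeomorph ⁻¹'
        (Set.univ.pi fun _ => Set.Icc (0 : ℝ) N) := by
      ext x
      exact ⟨fun h j _ => h j, fun h j => h j trivial⟩
    rw [this, Homeomorph.isCompact_preimage]
    exact isCompact_univ_pi fun _ => isCompact_Icc
  refine hc.memLp_of_hasCompactSupport (HasCompactSupport.intro hK fun x hx => ?_)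
  simp [window, Set.indicator_of_notMem hx]

/-- The sum of `sin ^ (2 (N - 1))` over `N` samples spaced by `π / N` does not depend on the offset. -/
theorem sum_sin_pow_equally_spaced {N : ℕ} (hN : 2 ≤ N) (θ : ℝ) :
    ∑ i ∈ Finset.range N, Real.sin (θ + Real.pi * i / N) ^ (2 * (N - 1)) =
      (N : ℝ) * ((2 * N - 2).choose (N - 1) : ℝ) / 4 ^ (N - 1) := by
  obtain ⟨M, rfl⟩ : ∃ M, N = M + 1 := ⟨N - 1, by omega⟩
  simp only [Nat.add_sub_cancel, show 2 * (M + 1) - 2 = 2 * M by omega]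
  set n : ℂ := ((M + 1 : ℕ) : ℂ) with hn
  have hn0 : n ≠ 0 := by rw [hn]; exact_mod_cast Nat.succ_ne_zero M
  -- A nonzero frequency gives a geometric sum whose ratio is an `N`-th root of unity, different
  -- from `1` because `|k - M| ≤ M < N`.
  have hsum : ∀ k ∈ Finset.range (2 * M + 1), k ≠ M →
      ∑ i ∈ Finset.range (M + 1),
        Complex.exp ((2 * ((k : ℂ) - M) * (θ + Real.pi * i / n)) * Complex.I) = 0 := by
    intro k hk hkM
    set z : ℂ := Complex.exp (2 * Real.pi * Complex.I * (((k : ℂ) - M) / n)) with hz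
    have hzN : z ^ (M + 1) = 1 := by
      rw [hz, ← Complex.exp_nat_mul, Complex.exp_eq_one_iff]
      refine ⟨(k : ℤ) - M, ?_⟩
      rw [← hn]; push_cast; field_simp
    have hz1 : z ≠ 1 := by
      rw [hz, Ne, Complex.exp_eq_one_iff]
      rintro ⟨a, ha⟩
      have h2 : ((k : ℂ) - M) / n = a := by
        have : (2 * Real.pi * Complex.I : ℂ) ≠ 0 := Complex.two_pi_I_ne_zero
        apply mul_left_cancel₀ this
        rw [ha]; ring
      rw [div_eq_iff hn0, hn] at h2
      have h3 : (k : ℤ) - M = a * ((M : ℤ) + 1) := by exact_mod_cast h2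
      rw [Finset.mem_range] at hk
      have ha0 : a = 0 := by
        by_contra hne
        rcases lt_or_gt_of_ne hne with h | h <;> nlinarith
      rw [ha0] at h3
      omega
    have hterm : ∀ i ∈ Finset.range (M + 1),
        Complex.exp ((2 * ((k : ℂ) - M) * (θ + Real.pi * i / n)) * Complex.I)
          = Complex.exp (2 * ((k : ℂ) - M) * θ * Complex.I) * z ^ i := by
      intro i _
      rw [hz, ← Complex.exp_nat_mul, ← Complex.exp_add]
      congr 1
      ring
    rw [Finset.sum_congr rfl hterm, ← Finset.mul_sum, geom_sum_eq hz1, hzN]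
    simp
  -- Binomial expansion of `(-1/4)^M (e^{iw} - e^{-iw})^(2M)`.
  have hpow : ∀ w : ℂ, Complex.sin w ^ (2 * M) = (1 / 4 ^ M) * ∑ k ∈ Finset.range (2 * M + 1),
      (-1) ^ (k + M) * ((2 * M).choose k : ℂ) *
        Complex.exp ((2 * ((k : ℂ) - M) * w) * Complex.I) := by
    intro w
    have h1 : Complex.sin w ^ (2 * M) = (1 / 4 ^ M) *
        ((-1) ^ M * (Complex.exp (w * Complex.I) - Complex.exp (-w * Complex.I)) ^ (2 * M)) := by
      have : Complex.sin w ^ 2 = (1 / 4) * ((-1) *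
          (Complex.exp (w * Complex.I) - Complex.exp (-w * Complex.I)) ^ 2) := by
        have := Complex.I_sq
        rw [Complex.sin]
        linear_combination (Complex.exp (w * Complex.I) - Complex.exp (-w * Complex.I)) ^ 2 / 4
          * this
      rw [pow_mul, this, mul_pow, mul_pow, pow_mul, one_div_pow]
    rw [h1, sub_eq_add_neg, add_pow, Finset.mul_sum]
    congr 1
    refine Finset.sum_congr rfl fun k hk => ?_
    rw [Finset.mem_range] at hk
    have hk' : k ≤ 2 * M := by omega
    rw [neg_pow (Complex.exp (-w * Complex.I)), ← Complex.exp_nat_mul, ← Complex.exp_nat_mul]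
    have hs : (-1 : ℂ) ^ (2 * M - k) = (-1) ^ k := by
      obtain ⟨c, hc⟩ := Nat.exists_eq_add_of_le hk'
      have h2 : (-1 : ℂ) ^ (k + c) = 1 := by rw [← hc, pow_mul]; simp
      have h3 : (-1 : ℂ) ^ k * (-1) ^ k = 1 := by rw [← pow_add, ← two_mul, pow_mul]; simp
      rw [hc, Nat.add_sub_cancel_left]
      calc (-1 : ℂ) ^ c = ((-1) ^ k * (-1) ^ k) * (-1) ^ c := by rw [h3, one_mul]
        _ = (-1) ^ k * (-1) ^ (k + c) := by rw [pow_add]; ring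
        _ = (-1) ^ k := by rw [h2, mul_one]
    rw [hs, Nat.cast_sub hk']
    have he : Complex.exp (k * (w * Complex.I)) *
        Complex.exp (((2 * M : ℕ) - k : ℂ) * (-w * Complex.I)) =
        Complex.exp ((2 * ((k : ℂ) - M) * w) * Complex.I) := by
      rw [← Complex.exp_add]; congr 1; push_cast; ring
    rw [← he, pow_add]
    ring
  have hC : ∑ i ∈ Finset.range (M + 1), Complex.sin (θ + Real.pi * i / n) ^ (2 * M) =
      n * ((2 * M).choose M : ℂ) / 4 ^ M := by
    simp only [hpow]
    rw [← Finset.mul_sum, Finset.sum_comm]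
    simp only [← Finset.mul_sum]
    rw [Finset.sum_eq_single M]
    · simp [← two_mul, pow_mul, hn]; ring
    · intro k hk hkM
      rw [hsum k hk hkM, mul_zero]
    · intro h
      exact absurd (Finset.mem_range.2 (by omega)) h
  apply Complex.ofReal_injective
  rw [hn] at hC
  push_cast at hC ⊢
  exact hC

end GaborL2

/-! ### Squares of the integer translates of the window -/

namespace GaborL2

theorem profile_sub_eq_zero_of_notMem {N : ℕ} (hN : 2 ≤ N) {t : ℝ} {n : ℤ}
    (hn : n ∉ Finset.Ioc (⌊t⌋ - (N : ℤ)) ⌊t⌋) : profile N (t - n) = 0 := by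
  refine profile_eq_zero hN fun ht => hn (Finset.mem_Ioc.2 ⟨?_, ?_⟩)
  · have h1 : (⌊t⌋ : ℝ) ≤ t := Int.floor_le t
    have h2 : ((⌊t⌋ - (N : ℤ) : ℤ) : ℝ) < n := by
      push_cast
      linarith [ht.2]
    exact_mod_cast h2
  · exact Int.le_floor.2 (by linarith [ht.1])

theorem sum_profile_sq {N : ℕ} (hN : 2 ≤ N) (t : ℝ) :
    ∑ n ∈ Finset.Ioc (⌊t⌋ - (N : ℤ)) ⌊t⌋, profile N (t - n) ^ 2 =
      (N : ℝ) * ((2 * N - 2).choose (N - 1) : ℝ) / 4 ^ (N - 1) := by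
  have hN0 : (0 : ℝ) < N := by positivity
  rw [← sum_sin_pow_equally_spaced hN (Real.pi * Int.fract t / N)]
  symm
  -- With `n = ⌊t⌋ - i`, the point `t - n = fract t + i` runs through `N` unit-spaced samples in
  -- `[0, N]`.
  refine Finset.sum_bij (fun i _ => ⌊t⌋ - (i : ℤ)) ?_ ?_ ?_ ?_
  · intro i hi
    rw [Finset.mem_range] at hi
    rw [Finset.mem_Ioc]
    omega
  · intro i _ j _ h
    have : ⌊t⌋ - (i : ℤ) = ⌊t⌋ - (j : ℤ) := h
    omega
  · intro n hn
    rw [Finset.mem_Ioc] at hn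
    refine ⟨(⌊t⌋ - n).toNat, Finset.mem_range.2 (by omega), ?_⟩
    have : ((⌊t⌋ - n).toNat : ℤ) = ⌊t⌋ - n := Int.toNat_of_nonneg (by omega)
    simp only [this]
    ring
  · intro i hi
    rw [Finset.mem_range] at hi
    have hiN : (i : ℝ) + 1 ≤ N := by exact_mod_cast hi
    have e : t - ((⌊t⌋ - (i : ℤ) : ℤ) : ℝ) = Int.fract t + i := by
      rw [Int.fract]; push_cast; ring
    have hmem : Int.fract t + i ∈ Set.Icc (0 : ℝ) N :=
      ⟨by positivity, by linarith [Int.fract_lt_one t]⟩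
    rw [e, profile, Set.indicator_of_mem hmem, ← pow_mul, mul_comm 2]
    congr 2
    ring

/-- The squares of the integer translates of the window add up to `|det B|`. -/
theorem hasSum_window_sq {d N : ℕ} (hN : 2 ≤ N) (B : Matrix (Fin d) (Fin d) ℝ)
    (x : EuclideanSpace ℝ (Fin d)) :
    HasSum (fun n : Fin d → ℤ => window N B (x - intVec n) ^ 2) |B.det| := by
  classical
  set c : ℝ := (N : ℝ) * ((2 * N - 2).choose (N - 1) : ℝ) / 4 ^ (N - 1) with hc
  have hc0 : 0 < c := by
    have : 0 < (2 * N - 2).choose (N - 1) := Nat.choose_pos (by omega)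
    positivity
  have hsq : ∀ n : Fin d → ℤ, window N B (x - intVec n) ^ 2 =
      |B.det| * c⁻¹ ^ d * ∏ j, profile N (x j - n j) ^ 2 := by
    intro n
    have h1 : (4 : ℝ) ^ (N - 1) / ((N : ℝ) * ((2 * N - 2).choose (N - 1) : ℝ)) = c⁻¹ := by
      rw [hc, inv_div]
    have h2 : ((c⁻¹) ^ ((d : ℝ) / 2)) ^ 2 = c⁻¹ ^ d := by
      rw [← Real.rpow_natCast, ← Real.rpow_mul (inv_pos.2 hc0).le, ← Real.rpow_natCast]
      congr 1
      push_cast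
      ring
    rw [window_eq_prod, h1, mul_pow, mul_pow, h2, Real.sq_sqrt (abs_nonneg _), Finset.prod_pow]
    rfl
  set t : ∀ _ : Fin d, Finset ℤ := fun j => Finset.Ioc (⌊x j⌋ - (N : ℤ)) ⌊x j⌋ with ht
  have hval : ∑ n ∈ Fintype.piFinset t, window N B (x - intVec n) ^ 2 = |B.det| := by
    simp only [hsq]
    rw [← Finset.mul_sum,
      ← Finset.prod_univ_sum t (fun j (n : ℤ) => profile N (x j - n) ^ 2)]
    simp only [ht, sum_profile_sq hN]
    rw [Finset.prod_const, Finset.card_univ, Fintype.card_fin, ← hc, mul_assoc, ← mul_pow,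
      inv_mul_cancel₀ hc0.ne', one_pow, mul_one]
  rw [← hval]
  refine hasSum_sum_of_ne_finset_zero fun n hn => ?_
  rw [Fintype.mem_piFinset] at hn
  push Not at hn
  obtain ⟨j, hj⟩ := hn
  rw [hsq, Finset.prod_eq_zero (Finset.mem_univ j), mul_zero]
  rw [profile_sub_eq_zero_of_notMem hN hj]
  simp

/-- One term of a nonnegative sum is at most the total. Boundedness keeps the product of the window
with `f` in `L²`. -/
theorem abs_window_le {d N : ℕ} (hN : 2 ≤ N) (B : Matrix (Fin d) (Fin d) ℝ)
    (x : EuclideanSpace ℝ (Fin d)) : |window N B x| ≤ √|B.det| := by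
  refine Real.abs_le_sqrt ?_
  have h := hasSum_window_sq hN B x
  have h0 := le_hasSum h 0 fun n _ => sq_nonneg _
  have e : x - intVec (0 : Fin d → ℤ) = x := by ext j; simp [intVec]
  rwa [e] at h0

theorem mem_Ioo_of_window_ne_zero {d N : ℕ} (hN : 2 ≤ N) {B : Matrix (Fin d) (Fin d) ℝ}
    {x : EuclideanSpace ℝ (Fin d)} (hx : window N B x ≠ 0) (j : Fin d) :
    x j ∈ Set.Ioo (0 : ℝ) N := by
  by_contra hcon
  refine hx ?_
  rw [window_eq_prod, Finset.prod_eq_zero (Finset.mem_univ j) (profile_eq_zero hN hcon), mul_zero]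

/-- The linear parametrization `y ↦ B^♯ y` of Euclidean space. -/
noncomputable def sharpMap {d : ℕ} (B : Matrix (Fin d) (Fin d) ℝ) (y : Fin d → ℝ) :
    EuclideanSpace ℝ (Fin d) :=
  act (sharp B) (WithLp.toLp 2 y)

/-! ### Change of variables along `B^♯` -/

section ChangeOfVariables

variable {d : ℕ} {B : Matrix (Fin d) (Fin d) ℝ}

theorem sharpMap_add_intCoe (y : Fin d → ℝ) (l : Fin d → ℤ) :
    sharpMap B (y + intCoe l) = sharpMap B y + act (sharp B) (intVec l) := by
  ext j
  exact congrFun (Matrix.mulVec_add (sharp B) y (intCoe l)) j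

theorem sharp_det (B : Matrix (Fin d) (Fin d) ℝ) : (sharp B).det = B.det⁻¹ := by
  rw [sharp, Matrix.det_nonsing_inv, Matrix.det_transpose, Ring.inverse_eq_inv']

theorem sharpMap_eq_comp (B : Matrix (Fin d) (Fin d) ℝ) :
    sharpMap B = WithLp.toLp 2 ∘ Matrix.toLin' (sharp B) := by
  ext y j
  simp [sharpMap, act]

theorem map_sharpMap_volume (hB : IsUnit B.det) :
    (volume : Measure (Fin d → ℝ)).map (sharpMap B) = ENNReal.ofReal |B.det| • volume := by
  have hdet : (sharp B).det ≠ 0 := by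
    rw [sharp_det]
    exact inv_ne_zero hB.ne_zero
  rw [sharpMap_eq_comp, ← Measure.map_map (PiLp.volume_preserving_toLp (Fin d)).measurable
    (LinearMap.continuous_of_finiteDimensional _).measurable,
    Real.map_matrix_volume_pi_eq_smul_volume_pi hdet, Measure.map_smul,
    (PiLp.volume_preserving_toLp (Fin d)).map_eq, sharp_det, inv_inv]

theorem measurableEmbedding_sharpMap (hB : IsUnit B.det) : MeasurableEmbedding (sharpMap B) := by
  have hdet : IsUnit (sharp B) := by
    rw [Matrix.isUnit_iff_isUnit_det, sharp_det]
    exact (inv_ne_zero hB.ne_zero).isUnit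
  rw [sharpMap_eq_comp]
  refine Continuous.measurableEmbedding ?_ ?_
  · exact (PiLp.continuous_toLp 2 _).comp (LinearMap.continuous_of_finiteDimensional _)
  · exact (WithLp.toLp_injective 2).comp (Matrix.mulVec_injective_of_isUnit hdet)

theorem integral_comp_sharpMap {E : Type*} [NormedAddCommGroup E] [NormedSpace ℝ E]
    (hB : IsUnit B.det) (F : EuclideanSpace ℝ (Fin d) → E) :
    ∫ y, F (sharpMap B y) = |B.det| • ∫ x, F x := by
  rw [← (measurableEmbedding_sharpMap hB).integral_map, map_sharpMap_volume hB,
    integral_smul_measure, ENNReal.toReal_ofReal (abs_nonneg _)]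

theorem inner_act_sharpMap (hB : IsUnit B.det) (m : Fin d → ℤ) (y : Fin d → ℝ) :
    inner ℝ (act B (intVec m)) (sharpMap B y) = ∑ j, (m j : ℝ) * y j := by
  have h : inner ℝ (act B (intVec m)) (sharpMap B y) =
      (B.mulVec (intCoe m)) ⬝ᵥ ((sharp B).mulVec y) := by
    rw [EuclideanSpace.inner_eq_star_dotProduct, dotProduct_comm]
    rfl
  rw [h, Matrix.dotProduct_mulVec, ← Matrix.vecMul_transpose, Matrix.vecMul_vecMul, sharp,
    Matrix.mul_nonsing_inv _ (by rwa [Matrix.det_transpose]), Matrix.vecMul_one]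
  rfl

/-- Plancherel on the lattice `B ℤ^d` for a function on `ℝ^d` whose support has pairwise disjoint
translates along the dual lattice `B^♯ ℤ^d`. -/
theorem hasSum_sq_integral_modulation (hB : IsUnit B.det) {g : EuclideanSpace ℝ (Fin d) → ℂ}
    (h1 : Integrable g) (h2 : MemLp g 2 volume)
    (hdisj : ∀ x (l : Fin d → ℤ), l ≠ 0 → g x ≠ 0 → g (x + act (sharp B) (intVec l)) = 0) :
    HasSum (fun m : Fin d → ℤ => ‖∫ x, modulation (act B (intVec m)) g x‖ ^ 2)
      (|B.det|⁻¹ * ∫ x, ‖g x‖ ^ 2) := by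
  have hb : 0 < |B.det| := abs_pos.2 hB.ne_zero
  have hemb := measurableEmbedding_sharpMap hB
  have i1 : Integrable fun y => g (sharpMap B y) := by
    have := h1.smul_measure (c := ENNReal.ofReal |B.det|) ENNReal.ofReal_ne_top
    rw [← map_sharpMap_volume hB] at this
    exact hemb.integrable_map_iff.1 this
  have i2 : MemLp (fun y => g (sharpMap B y)) 2 volume := by
    have := h2.smul_measure (c := ENNReal.ofReal |B.det|) ENNReal.ofReal_ne_top
    rw [← map_sharpMap_volume hB] at this
    exact hemb.memLp_map_measure_iff.1 this
  have key := hasSum_sq_integral_character i1 i2 fun y n hn hy => by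
    rw [sharpMap_add_intCoe]
    exact hdisj _ n hn hy
  rw [integral_comp_sharpMap hB fun x => ‖g x‖ ^ 2] at key
  have hcoef : ∀ m : Fin d → ℤ, ∫ y, character m y * g (sharpMap B y) =
      |B.det| • ∫ x, modulation (act B (intVec m)) g x := by
    intro m
    rw [← integral_comp_sharpMap hB]
    refine integral_congr_ae (Filter.Eventually.of_forall fun y => ?_)
    simp only [modulation, inner_act_sharpMap hB, character]
  simp only [hcoef, norm_smul, Real.norm_eq_abs, abs_abs, mul_pow] at key
  -- The Jacobian `|det B|` enters squared on the coefficient side and once on the norm side,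
  -- leaving `|det B|⁻¹`.
  have := key.mul_left ((|B.det| ^ 2)⁻¹)
  have e : (|B.det| ^ 2)⁻¹ * (|B.det| • ∫ x, ‖g x‖ ^ 2) = |B.det|⁻¹ * ∫ x, ‖g x‖ ^ 2 := by
    rw [smul_eq_mul]; field_simp
  rw [e] at this
  refine this.congr_fun fun m => ?_
  field_simp

end ChangeOfVariables

/-! ### The frame identity -/

theorem hasSum_prod_of_nonneg {α β : Type*} {F : α × β → ℝ} (hF : 0 ≤ F) {a : α → ℝ} {A : ℝ}
    (h : ∀ x, HasSum (fun y => F (x, y)) (a x)) (ha : HasSum a A) : HasSum F A := by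
  have hs : Summable F := (summable_prod_of_nonneg hF).2
    ⟨fun x => (h x).summable, by simpa only [(h _).tsum_eq] using ha.summable⟩
  have := hs.hasSum.prod_fiberwise h
  rw [ha.unique this]
  exact hs.hasSum

variable {d N : ℕ} {B : Matrix (Fin d) (Fin d) ℝ}

theorem hasSum_integral_window_sq (hN : 2 ≤ N)
    (f : Lp ℂ 2 (volume : Measure (EuclideanSpace ℝ (Fin d)))) :
    HasSum (fun n : Fin d → ℤ => ∫ x, window N B (x - intVec n) ^ 2 * ‖f x‖ ^ 2)
      (|B.det| * ‖f‖ ^ 2) := by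
  have hf2 : Integrable fun x => ‖f x‖ ^ 2 :=
    (memLp_two_iff_integrable_sq_norm (Lp.memLp f).1).1 (Lp.memLp f)
  have hnorm : ‖f‖ ^ 2 = ∫ x, ‖f x‖ ^ 2 := by
    have h := L2.inner_def (𝕜 := ℂ) f f
    rw [inner_self_eq_norm_sq_to_K] at h
    simp only [inner_self_eq_norm_sq_to_K] at h
    have e : (fun x => ((‖f x‖ : ℝ) : ℂ) ^ 2) = fun x => ((‖f x‖ ^ 2 : ℝ) : ℂ) := by
      ext x; push_cast; rfl
    apply Complex.ofReal_injective
    rw [← integral_complex_ofReal, ← e, Complex.ofReal_pow]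
    exact h
  have hpt : ∀ x, HasSum (fun n : Fin d → ℤ => window N B (x - intVec n) ^ 2 * ‖f x‖ ^ 2)
      (|B.det| * ‖f x‖ ^ 2) := fun x => (hasSum_window_sq hN B x).mul_right _
  rw [hnorm, ← integral_const_mul]
  -- The terms are nonnegative and dominate themselves; their sum `|det B| * ‖f x‖ ^ 2` is
  -- integrable.
  refine hasSum_integral_of_dominated_convergence
    (fun n x => window N B (x - intVec n) ^ 2 * ‖f x‖ ^ 2) (fun n => ?_)
    (fun n => Filter.Eventually.of_forall fun x => ?_)
    (Filter.Eventually.of_forall fun x => (hpt x).summable) ?_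
    (Filter.Eventually.of_forall hpt)
  · have hc : Continuous fun x : EuclideanSpace ℝ (Fin d) => window N B (x - intVec n) ^ 2 :=
      ((contDiff_window hN B).continuous.comp (continuous_sub_right _)).pow 2
    exact hc.aestronglyMeasurable.mul hf2.1
  · rw [Real.norm_of_nonneg (by positivity)]
  · simp only [(hpt _).tsum_eq]
    exact hf2.const_mul _

theorem hasSum_sq_inner_gaborSystem (hN : 2 ≤ N) (hB : IsUnit B.det)
    (hcube : ∀ n : Fin d → ℤ, n ≠ 0 → act (sharp B) (intVec n) ∉ openCube d N)
    (hk : MemLp (fun x => (window N B x : ℂ)) 2 volume)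
    (f : Lp ℂ 2 (volume : Measure (EuclideanSpace ℝ (Fin d)))) (n : Fin d → ℤ) :
    HasSum (fun m : Fin d → ℤ =>
        ‖(inner ℂ f (gaborSystem B (fun x => (window N B x : ℂ)) hk (m, n)) : ℂ)‖ ^ 2)
      (|B.det|⁻¹ * ∫ x, window N B (x - intVec n) ^ 2 * ‖f x‖ ^ 2) := by
  set g : EuclideanSpace ℝ (Fin d) → ℂ :=
    fun x => (window N B (x - intVec n) : ℂ) * (starRingEnd ℂ) (f x) with hg
  have hkn : MemLp (fun x => (window N B (x - intVec n) : ℂ)) 2 volume :=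
    memLp_translation (intVec n) hk
  have hfc : MemLp (fun x => (starRingEnd ℂ) (f x)) 2 volume := (Lp.memLp f).star
  have h1 : Integrable g := hkn.integrable_mul hfc
  have h2 : MemLp g 2 volume := by
    refine MemLp.of_le_mul (c := √|B.det|) hfc h1.1 (Filter.Eventually.of_forall fun x => ?_)
    rw [hg, norm_mul, Complex.norm_real, Real.norm_eq_abs]
    exact mul_le_mul_of_nonneg_right (abs_window_le hN B _) (norm_nonneg _)
  have hdisj : ∀ x (l : Fin d → ℤ), l ≠ 0 → g x ≠ 0 →
      g (x + act (sharp B) (intVec l)) = 0 := by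
    intro x l hl hx
    by_contra hx'
    have w1 : window N B (x - intVec n) ≠ 0 := fun h => hx (by simp [hg, h])
    have w2 : window N B (x + act (sharp B) (intVec l) - intVec n) ≠ 0 :=
      fun h => hx' (by simp [hg, h])
    -- Two points of the open cube `n + (0, N)^d` differ by a vector of `(-N, N)^d`.
    refine hcube l hl fun j => ?_
    have b1 := mem_Ioo_of_window_ne_zero hN w1 j
    have b2 := mem_Ioo_of_window_ne_zero hN w2 j
    simp only [PiLp.sub_apply, PiLp.add_apply, Set.mem_Ioo] at b1 b2
    constructor <;> linarith [b1.1, b1.2, b2.1, b2.2]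
  have key := hasSum_sq_integral_modulation hB h1 h2 hdisj
  have e : ∀ x, ‖g x‖ ^ 2 = window N B (x - intVec n) ^ 2 * ‖f x‖ ^ 2 := by
    intro x
    rw [hg, norm_mul, Complex.norm_real, Real.norm_eq_abs, mul_pow, sq_abs, RCLike.norm_conj]
  simp only [e] at key
  refine key.congr_fun fun m => ?_
  rw [L2.inner_def]
  congr 2
  refine integral_congr_ae ?_
  filter_upwards [MemLp.coeFn_toLp (memLp_modulation (act B (intVec m))
    (memLp_translation (intVec n) hk))] with x hx
  rw [gaborSystem, hx, RCLike.inner_apply]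
  simp only [modulation, translation, hg]
  ring

end GaborL2

theorem corollary4p2 (d N : ℕ) (hN : 2 ≤ N) (B : Matrix (Fin d) (Fin d) ℝ) (hB : IsUnit B.det)
    (hcube : ∀ n : Fin d → ℤ, n ≠ 0 →
      GaborL2.act (GaborL2.sharp B) (GaborL2.intVec n) ∉ GaborL2.openCube d N) :
    ContDiff ℝ ((N - 2 : ℕ) : WithTop ℕ∞) (GaborL2.window N B) ∧
      ∃ hk : MemLp (fun x => (GaborL2.window N B x : ℂ)) 2 volume,
        GaborL2.IsTightFrame (GaborL2.gaborSystem B (fun x => (GaborL2.window N B x : ℂ)) hk) 1 := by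
  refine ⟨GaborL2.contDiff_window hN B, GaborL2.memLp_window hN B, one_pos, fun f => ?_⟩
  have hb : |B.det| ≠ 0 := abs_ne_zero.2 hB.ne_zero
  have hn := (GaborL2.hasSum_integral_window_sq (B := B) hN f).mul_left |B.det|⁻¹
  rw [inv_mul_cancel_left₀ hb] at hn
  -- The swap makes `n` the outer index, since Parseval sums over `m` with `n` fixed.
  rw [one_mul, ← (Equiv.prodComm (Fin d → ℤ) (Fin d → ℤ)).hasSum_iff]
  exact GaborL2.hasSum_prod_of_nonneg (fun _ => sq_nonneg _)
    (GaborL2.hasSum_sq_inner_gaborSystem hN hB hcube (GaborL2.memLp_window hN B) f) hn
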